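/- Let $k$ be a field of characteristic $0$, let $n\ge 0$, and let $F_n=k((t_1))\cdots((t_n))$ be the field of iterated formal Laurent series, defined by $F_0=k$ and $F_m=F_{m-1}((t_m))$. Let $\partial_{t_1},\dots,\partial_{t_n}$ be the formal partial derivatives of $F_n$, let $\Omega^1_{F_n}=\bigoplus_{i=1}^n F_n\,dt_i$ with $df=\sum_i \partial_{t_i}(f)\,dt_i$ for $f\in F_n$, and let $\Omega^p_{F_n}=\bigwedge^p_{F_n}\Omega^1_{F_n}$. Let $(E,\nabla)$ be a flat connection on $F_n$, that is, a finite-dimensional $F_n$-vector space $E$ with a $k$-linear map $\nabla\colon E\to E\otimes_{F_n}\Omega^1_{F_n}$ such that $\nabla(fe)=f\,\nabla e+e\otimes df$ for all $f\in F_n$, $e\in E$, and such that the composite $E\to E\otimes\Omega^1_{F_n}\to E\otimes\Omega^2_{F_n}$ is zero, where $\nabla$ is extended to $E\otimes\Omega^p_{F_n}\to E\otimes\Omega^{p+1}_{F_n}$ by $\nabla(e\otimes\omega)=\nabla e\wedge\omega+e\otimes d\omega$; here $\nabla e\wedge\omega$ stands for $\sum_j e_j\otimes(\eta_j\wedge\omega)$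 if $\nabla e=\sum_j e_j\otimes\eta_j$. Then for every $i\in\mathbb Z$ the cohomology group $H^i_\nabla(E)$ of the de Rham complex $$E\xrightarrow{\ \nabla\ }E\otimes_{F_n}\Omega^1_{F_n}\xrightarrow{\ \nabla\ }\cdots\xrightarrow{\ \nabla\ }E\otimes_{F_n}\Omega^n_{F_n},$$ with $E$ in degree $0$ and zero terms in degrees outside $0,\dots,n$, is a finite-dimensional $k$-vector space. -/

import Mathlib

open scoped TensorProduct

universe u v

noncomputable section

/-- The iterated Laurent series field together with its field structure, built by recursion. -/
def HigherLocalField.bundled (k : Type u) [Field k] : ℕ → Σ K : Type u, Field K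
  | 0 => ⟨k, inferInstance⟩
  | n + 1 =>
    let K := HigherLocalField.bundled k n
    letI : Field K.1 := K.2
    ⟨LaurentSeries K.1, inferInstance⟩

/-- The higher local field `F_n = k((t_1))((t_2))⋯((t_n))`: `F_0 = k` and
`F_{n+1} = F_n((t_{n+1}))`. The variable `t_{i+1}` corresponds to the index `i : Fin n`, so that
the outermost variable `t_n` corresponds to the last index. -/
def HigherLocalField (k : Type u) [Field k] (n : ℕ) : Type u :=
  (HigherLocalField.bundled k n).1

namespace HigherLocalField

variable (k : Type u) [Field k]

instance instField (n : ℕ) : Field (HigherLocalField k n) :=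
  (bundled k n).2

/-- `F_{n+1}` is the field of Laurent series over `F_n`. -/
def succRingEquiv (n : ℕ) :
    HigherLocalField k (n + 1) ≃+* LaurentSeries (HigherLocalField k n) where
  toFun f := f
  invFun f := f
  left_inv _ := rfl
  right_inv _ := rfl
  map_mul' _ _ := rfl
  map_add' _ _ := rfl

/-- The `k`-algebra structure of `F_n`, through constant series. -/
@[reducible] def algebraAux : (n : ℕ) → Algebra k (HigherLocalField k n)
  | 0 => Algebra.id k
  | n + 1 =>
    letI : Algebra k (HigherLocalField k n) := algebraAux n
    ((succRingEquiv k n).symm.toRingHom.comp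
      (HahnSeries.C.comp (algebraMap k (HigherLocalField k n)))).toAlgebra

instance instAlgebra (n : ℕ) : Algebra k (HigherLocalField k n) := algebraAux k n

/-- `F_{n+1}` is the `k`-vector space of Laurent series over `F_n`. -/
def succEquiv (n : ℕ) :
    HigherLocalField k (n + 1) ≃ₗ[k] LaurentSeries (HigherLocalField k n) :=
  { (succRingEquiv k n).toAddEquiv with
    map_smul' := fun a f => by
      have h : succRingEquiv k n (a • f) =
          HahnSeries.C (algebraMap k (HigherLocalField k n) a) * succRingEquiv k n f := rfl
      refine h.trans ?_
      ext m
      rw [HahnSeries.C_mul_eq_smul, HahnSeries.coeff_smul, algebraMap_smul]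
      rfl }

variable {k}

/-- A `k`-linear operator applied to each coefficient of a Laurent series. -/
def mapCoeff {A : Type u} [Field A] [Algebra k A] (D : A →ₗ[k] A) :
    LaurentSeries A →ₗ[k] LaurentSeries A where
  toFun f := HahnSeries.map f D
  map_add' f g := by ext m; simp
  map_smul' c f := by ext m; simp

variable (k)

/-- The partial derivatives `∂/∂t_i` of `F_n`: on `F_{n+1} = F_n((t))`, the last one is the formal
derivative `∑ a_m t^m ↦ ∑ m a_m t^(m-1)`, and the others act on the coefficients `a_m ∈ F_n`. -/
def partialDeriv : (n : ℕ) → Fin n → HigherLocalField k n →ₗ[k] HigherLocalField k n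
  | 0 => fun i => i.elim0
  | n + 1 => fun i =>
    Fin.lastCases
      (motive := fun _ => HigherLocalField k (n + 1) →ₗ[k] HigherLocalField k (n + 1))
      ((succEquiv k n).symm.toLinearMap ∘ₗ LaurentSeries.derivative k ∘ₗ
        (succEquiv k n).toLinearMap)
      (fun j => (succEquiv k n).symm.toLinearMap ∘ₗ mapCoeff (partialDeriv n j) ∘ₗ
        (succEquiv k n).toLinearMap)
      i

/-- The module `Ω¹` of formal one-forms on `F_n`: the free `F_n`-module on `dt_1, …, dt_n`;
a function `c` stands for `∑ c_i dt_i`. -/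
abbrev OneForms (n : ℕ) : Type u := Fin n → HigherLocalField k n

/-- The basis `dt_1, …, dt_n` of `Ω¹`. -/
def dt (n : ℕ) : Module.Basis (Fin n) (HigherLocalField k n) (OneForms k n) :=
  Pi.basisFun (HigherLocalField k n) (Fin n)

/-- The differential `d f = ∑ (∂f/∂t_i) dt_i`. -/
def d (n : ℕ) (f : HigherLocalField k n) : OneForms k n :=
  ∑ i, partialDeriv k n i f • dt k n i

/-- The module `Ω^p` of formal `p`-forms on `F_n`, the `p`-th exterior power of `Ω¹`. -/
abbrev Forms (n p : ℕ) : Type u := ⋀[HigherLocalField k n]^p (OneForms k n)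

/-- The basis of `Ω^p` formed by the `dt_{i_1} ∧ ⋯ ∧ dt_{i_p}` with `i_1 < ⋯ < i_p`. -/
def dtBasis (n p : ℕ) :
    Module.Basis (Set.powersetCard (Fin n) p) (HigherLocalField k n) (Forms k n p) :=
  (dt k n).exteriorPower p

variable {k}

/-- The exterior product `ω ↦ η ∧ ω` of a `p`-form `ω` by a one-form `η`. -/
def wedge {n p : ℕ} :
    OneForms k n →ₗ[HigherLocalField k n] Forms k n p →ₗ[HigherLocalField k n]
      Forms k n (p + 1) :=
  LinearMap.mk₂ _
    (fun η ω => ⟨ExteriorAlgebra.ι _ η * (ω : ExteriorAlgebra _ (OneForms k n)), by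
      rw [ExteriorAlgebra.exteriorPower, pow_succ']
      exact Submodule.mul_mem_mul (LinearMap.mem_range_self _ _) ω.2⟩)
    (fun η₁ η₂ ω => by ext1; simp [add_mul])
    (fun c η ω => by ext1; simp)
    (fun η ω₁ ω₂ => by ext1; simp [mul_add])
    (fun c η ω => by ext1; simp)

end HigherLocalField

open HigherLocalField

section

variable (k : Type u) [Field k] (n : ℕ)
variable (E : Type v) [AddCommGroup E] [Module k E] [Module (HigherLocalField k n) E]
  [IsScalarTower k (HigherLocalField k n) E]

/-- A formal connection on the `F_n`-vector space `E`: a `k`-linear map `∇ : E → E ⊗ Ω¹` that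
satisfies the Leibniz rule. -/
structure FormalConnection where
  /-- The underlying `k`-linear map. -/
  nabla : E →ₗ[k] E ⊗[HigherLocalField k n] OneForms k n
  leibniz : ∀ (f : HigherLocalField k n) (e : E),
    nabla (f • e) = f • nabla e + e ⊗ₜ[HigherLocalField k n] d k n f

end

namespace FormalConnection

variable {k : Type u} [Field k] {n : ℕ}
variable {E : Type v} [AddCommGroup E] [Module k E] [Module (HigherLocalField k n) E]
  [IsScalarTower k (HigherLocalField k n) E]

/-- The exterior product `α ↦ α ∧ ω`, from `E ⊗ Ω¹` to `E ⊗ Ω^(p+1)`, by a `p`-form `ω`: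
it sends `e ⊗ η` to `e ⊗ (η ∧ ω)`. -/
def wedgeRight {p : ℕ} (ω : Forms k n p) :
    E ⊗[HigherLocalField k n] OneForms k n →ₗ[HigherLocalField k n]
      E ⊗[HigherLocalField k n] Forms k n (p + 1) :=
  LinearMap.lTensor E (wedge.flip ω)

/-- The coefficient `e_I ∈ E` of `dt_I` in an element `∑ e_I ⊗ dt_I` of `E ⊗ Ω^p`. -/
def coeff {p : ℕ} (I : Set.powersetCard (Fin n) p) :
    E ⊗[HigherLocalField k n] Forms k n p →ₗ[HigherLocalField k n] E :=
  Finsupp.lapply I ∘ₗ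
    (TensorProduct.equivFinsuppOfBasisRight (M := E) (dtBasis k n p)).toLinearMap

/-- The extension of a connection to `∇ : E ⊗ Ω^p → E ⊗ Ω^(p+1)`. An element of `E ⊗ Ω^p` is
uniquely of the form `∑ e_I ⊗ dt_I`, with `dt_I = dt_{i_1} ∧ ⋯ ∧ dt_{i_p}` for
`I = {i_1 < ⋯ < i_p}`, and since the forms `dt_I` are closed the rule
`∇(e ⊗ ω) = ∇e ∧ ω + e ⊗ dω` gives `∇(∑ e_I ⊗ dt_I) = ∑ ∇(e_I) ∧ dt_I`. -/
def extend (c : FormalConnection k n E) (p : ℕ) :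
    E ⊗[HigherLocalField k n] Forms k n p →ₗ[k]
      E ⊗[HigherLocalField k n] Forms k n (p + 1) :=
  ∑ I : Set.powersetCard (Fin n) p,
    (wedgeRight (dtBasis k n p I)).restrictScalars k ∘ₗ c.nabla ∘ₗ (coeff I).restrictScalars k

/-- A connection is flat if the composite `E → E ⊗ Ω¹ → E ⊗ Ω²` vanishes (where `E` and `Ω¹` are
identified with `E ⊗ Ω⁰` and with the first exterior power of `Ω¹`). -/
def IsFlat (c : FormalConnection k n E) : Prop :=
  c.extend 1 ∘ₗ c.extend 0 = 0

/-- The cocycles in degree `p` of the de Rham complex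
`E ⊗ Ω⁰ → E ⊗ Ω¹ → ⋯ → E ⊗ Ω^n → 0`. -/
def cocycles (c : FormalConnection k n E) (p : ℕ) :
    Submodule k (E ⊗[HigherLocalField k n] Forms k n p) :=
  LinearMap.ker (c.extend p)

/-- The coboundaries in degree `p` of the de Rham complex. -/
def coboundaries (c : FormalConnection k n E) :
    (p : ℕ) → Submodule k (E ⊗[HigherLocalField k n] Forms k n p)
  | 0 => ⊥
  | p + 1 => LinearMap.range (c.extend p)

/-- The de Rham cohomology `H^i` of a flat connection, in all degrees `i : ℤ`: cocycles modulo
coboundaries. The complex is zero in negative degrees. -/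
def deRhamCohomology (c : FormalConnection k n E) : ℤ → ModuleCat.{max u v} k
  | Int.ofNat p => ModuleCat.of k
      (c.cocycles p ⧸ (c.coboundaries p).comap (c.cocycles p).subtype)
  | Int.negSucc _ => ModuleCat.of k PUnit

end FormalConnection

end

noncomputable section

/-! ### Differential operators on K((t)). -/

namespace LaurentSeries

variable {K : Type u} [Field K]

/-! In the basis dt_1, …, dt_n a flat connection is a family of commuting operators D_j, each
satisfying the Leibniz rule for ∂_j, and its de Rham complex is their Koszul complex. One inducts on
n over all such families (`koszul_hasFiniteHomology`). The last operator is linear over F_{n-1} and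
is a one-variable connection over F_{n-1}((t_n)). Its kernel and cokernel are finite-dimensional
over F_{n-1} and inherit the other operators, so the induction hypothesis applies to both. The full
complex is the cone of D_n, and exactness of H(ker) → H → H(coker) concludes
(`koszul_hasFiniteHomology_succ`).

The analytic input is the one-variable case in characteristic 0. The kernel is easy
(`finite_ker_of_leibniz`). For the cokernel (`finite_coker_of_leibniz`), integration by parts along
the D-orbit of a vector reduces to a nonzero scalar operator P. On leading terms P shifts exponents
by a constant and multiplies by the value at m of a nonzero polynomial. This has finitely many
integer roots, so P f = g is solvable term by term up to finitely many monomials.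

Koszul homology is treated as a single ungraded object; degrees are separated only at the end. -/

theorem coeff_mul_of_coeff_eq_zero {x y : LaurentSeries K} {a b : ℤ}
    (hx : ∀ i < a, x.coeff i = 0) (hy : ∀ i < b, y.coeff i = 0) :
    (∀ i < a + b, (x * y).coeff i = 0) ∧ (x * y).coeff (a + b) = x.coeff a * y.coeff b := by
  constructor
  · intro i hi
    rw [HahnSeries.coeff_mul]
    refine Finset.sum_eq_zero fun ij hij => ?_
    rw [Finset.mem_antidiagonal] at hij
    by_cases h : ij.1 < a
    · rw [hx _ h, zero_mul]
    · rw [hy ij.2 (by linarith [hij.2.2]), mul_zero]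
  · rw [HahnSeries.coeff_mul]
    refine Finset.sum_eq_single (a, b) (fun ij hij hne => ?_) (fun h => ?_)
    · rw [Finset.mem_antidiagonal] at hij
      by_cases h : ij.1 < a
      · rw [hx _ h, zero_mul]
      · rw [hy ij.2, mul_zero]
        refine lt_of_not_ge fun h' => hne (Prod.ext ?_ ?_) <;> simp only <;> linarith [hij.2.2]
    · rw [Finset.mem_antidiagonal] at h
      by_contra h'
      exact h ⟨left_ne_zero_of_mul h', right_ne_zero_of_mul h', rfl⟩

theorem exists_forall_lt_coeff_eq_zero (f : LaurentSeries K) :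
    ∃ m : ℤ, ∀ i < m, f.coeff i = 0 :=
  ⟨f.order, fun _ hi => HahnSeries.coeff_eq_zero_of_lt_order hi⟩

/-- An operator that acts on leading terms through a polynomial without integer roots `≥ N`
is surjective onto the series of high order. -/
theorem mem_range_of_indicial (P : LaurentSeries K →ₗ[K] LaurentSeries K) (φ : ℤ → K) (s N : ℤ)
    (hP : ∀ (m : ℤ) (f : LaurentSeries K), (∀ i < m, f.coeff i = 0) →
      (∀ i < m - s, (P f).coeff i = 0) ∧ (P f).coeff (m - s) = φ m * f.coeff m)
    (hN : ∀ m ≥ N, φ m ≠ 0) (g : LaurentSeries K) (hg : ∀ i < N - s, g.coeff i = 0) :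
    g ∈ LinearMap.range P := by
  -- Successive approximation: g - P (h j) vanishes below N + j - s, and the next monomial cancels
  -- its coefficient there.
  obtain ⟨h, hzero, hsucc⟩ : ∃ h : ℕ → LaurentSeries K, h 0 = 0 ∧ ∀ j : ℕ, h (j + 1) = h j +
      HahnSeries.single (N + j) ((φ (N + j))⁻¹ * (g - P (h j)).coeff (N + j - s)) :=
    ⟨fun j => Nat.rec 0 (fun j hj => hj +
      HahnSeries.single (N + j) ((φ (N + j))⁻¹ * (g - P hj).coeff (N + j - s))) j,
      rfl, fun _ => rfl⟩
  have hh : ∀ j : ℕ, ∀ i < N + j - s, (g - P (h j)).coeff i = 0 := by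
    intro j
    induction j with
    | zero =>
      intro i hi
      rw [hzero, map_zero, sub_zero]
      exact hg i (by simpa using hi)
    | succ j ih =>
      intro i hi
      set c := (φ (N + j))⁻¹ * (g - P (h j)).coeff (N + j - s) with hc
      obtain ⟨h1, h2⟩ := hP (N + j) (HahnSeries.single (N + j) c)
        (fun i hi => HahnSeries.coeff_single_of_ne hi.ne)
      rw [hsucc, map_add, ← sub_sub, HahnSeries.coeff_sub]
      rcases lt_or_eq_of_le (show i ≤ N + j - s by push_cast at hi; linarith) with hlt | rfl
      · rw [ih i hlt, h1 i hlt, sub_zero]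
      · rw [h2, HahnSeries.coeff_single_same, hc, mul_inv_cancel_left₀ (hN _ (by simp)), sub_self]
  have hlow : ∀ j : ℕ, ∀ i < N, (h j).coeff i = 0 := by
    intro j
    induction j with
    | zero => intro i _; rw [hzero, HahnSeries.coeff_zero]
    | succ j ih =>
      intro i hi
      rw [hsucc, HahnSeries.coeff_add, ih i hi,
        HahnSeries.coeff_single_of_ne (by have := Int.natCast_nonneg j; linarith), zero_add]
  have hstab : ∀ j l : ℕ, j ≤ l → ∀ i < N + j, (h l).coeff i = (h j).coeff i := by
    intro j l hjl
    induction l, hjl using Nat.le_induction with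
    | base => intro i _; rfl
    | succ l hl ih =>
      intro i hi
      rw [hsucc, HahnSeries.coeff_add, ih i hi, HahnSeries.coeff_single_of_ne
        (by have : (j : ℤ) ≤ l := by exact_mod_cast hl
            linarith), add_zero]
  -- `h j` is final only below N + j, so coefficient i is read at stage i - N + 1.
  let f : LaurentSeries K := HahnSeries.ofSuppBddBelow
    (fun i : ℤ => (h ((i - N).toNat + 1)).coeff i) ⟨N, fun i hi => by
      by_contra hlt
      exact hi (hlow ((i - N).toNat + 1) i (not_le.mp hlt))⟩
  have hf : ∀ j : ℕ, ∀ i < N + j, (f - h j).coeff i = 0 := by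
    intro j i hi
    rw [HahnSeries.coeff_sub, sub_eq_zero]
    change (h ((i - N).toNat + 1)).coeff i = _
    by_cases hiN : i < N
    · rw [hlow _ i hiN, hlow _ i hiN]
    · exact (hstab ((i - N).toNat + 1) j (by omega) i (by push_cast; omega)).symm
  refine ⟨f, ?_⟩
  ext i
  -- Large enough that i < N + j - s; `hP` for f - h j then replaces any continuity of P.
  let j := (i + s - N + 1).toNat
  have h1 := (hP (N + j) (f - h j) (hf j)).1 i (by omega)
  have h2 := hh j i (by omega)
  rw [map_sub, HahnSeries.coeff_sub] at h1
  rw [HahnSeries.coeff_sub] at h2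
  rw [sub_eq_zero.mp h1, sub_eq_zero.mp h2]

/-- If φ m ≠ 0, then P reaches t^(m-s) up to higher terms; the finitely many other monomials span W.
Above the last root every series is in the range, and the order is lowered one step at a time from
there. -/
theorem exists_finite_sup_range_of_indicial
    (P : LaurentSeries K →ₗ[K] LaurentSeries K) (φ : ℤ → K) (s : ℤ)
    (hP : ∀ (m : ℤ) (f : LaurentSeries K), (∀ i < m, f.coeff i = 0) →
      (∀ i < m - s, (P f).coeff i = 0) ∧ (P f).coeff (m - s) = φ m * f.coeff m)
    (hφ : {m | φ m = 0}.Finite) :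
    ∃ W : Submodule K (LaurentSeries K), FiniteDimensional K W ∧ W ⊔ LinearMap.range P = ⊤ := by
  obtain ⟨B, hB⟩ := hφ.bddAbove
  set T : Set (LaurentSeries K) :=
    (fun m : ℤ => HahnSeries.single (m - s) (1 : K)) '' {m | φ m = 0} with hT
  refine ⟨Submodule.span K T, FiniteDimensional.span_of_finite K (hφ.image _), ?_⟩
  rw [eq_top_iff]
  have key : ∀ (j : ℕ) (g : LaurentSeries K), (∀ i < B + 1 - j - s, g.coeff i = 0) →
      g ∈ Submodule.span K T ⊔ LinearMap.range P := by
    intro j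
    induction j with
    | zero =>
      intro g hg
      refine Submodule.mem_sup_right (mem_range_of_indicial P φ s (B + 1) hP ?_ g (by simpa using hg))
      intro m hm h0
      have := hB h0
      omega
    | succ j ih =>
      intro g hg
      set m : ℤ := B + 1 - (j + 1 : ℕ) with hm
      have hle : ∀ i < B + 1 - j - s, i < m - s ∨ i = m - s := by intro i hi; omega
      by_cases h0 : φ m = 0
      · have hmem : g.coeff (m - s) • HahnSeries.single (m - s) (1 : K) ∈
            Submodule.span K T ⊔ LinearMap.range P :=
          Submodule.mem_sup_left (Submodule.smul_mem _ _ (Submodule.subset_span ⟨m, h0, rfl⟩))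
        rw [← sub_add_cancel g (g.coeff (m - s) • HahnSeries.single (m - s) (1 : K))]
        refine Submodule.add_mem _ (ih _ fun i hi => ?_) hmem
        rw [HahnSeries.coeff_sub, HahnSeries.coeff_smul]
        rcases hle i hi with h | rfl
        · rw [hg i h, HahnSeries.coeff_single_of_ne h.ne, smul_zero, sub_zero]
        · rw [HahnSeries.coeff_single_same, smul_eq_mul, mul_one, sub_self]
      · obtain ⟨h1, h2⟩ := hP m (HahnSeries.single m ((φ m)⁻¹ * g.coeff (m - s)))
          (fun i hi => HahnSeries.coeff_single_of_ne hi.ne)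
        rw [← sub_add_cancel g (P (HahnSeries.single m ((φ m)⁻¹ * g.coeff (m - s))))]
        refine Submodule.add_mem _ (ih _ fun i hi => ?_) (Submodule.mem_sup_right ⟨_, rfl⟩)
        rw [HahnSeries.coeff_sub]
        rcases hle i hi with h | rfl
        · rw [hg i h, h1 i h, sub_zero]
        · rw [h2, HahnSeries.coeff_single_same, mul_inv_cancel_left₀ h0, sub_self]
  intro g _
  obtain ⟨a, ha⟩ := exists_forall_lt_coeff_eq_zero g
  refine key (B + 1 - s - a).toNat g fun i hi => ha i ?_
  omega

theorem derivative_pow_coeff (i : ℕ) (f : LaurentSeries K) (m : ℤ) :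
    ((derivative K ^ i) f).coeff m =
      (descPochhammer K i).eval ((m + i : ℤ) : K) * f.coeff (m + i) := by
  rw [Module.End.pow_apply, derivative_iterate_coeff, ← Polynomial.eval_eq_smeval,
    ← Int.cast_smul_eq_zsmul K, smul_eq_mul]
  congr 1
  rw [← descPochhammer_map (Int.castRingHom K), Polynomial.eval_intCast_map]
  simp

/-- Multiplication by a Laurent series, as a `K`-linear map. -/
def mulLeft (b : LaurentSeries K) : LaurentSeries K →ₗ[K] LaurentSeries K where
  toFun f := b * f
  map_add' f g := mul_add b f g
  map_smul' c f := by
    rw [← HahnSeries.C_mul_eq_smul, ← HahnSeries.C_mul_eq_smul, RingHom.id_apply, mul_left_comm]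

/-- A nonzero linear differential operator on `K((t))` has finite-dimensional cokernel. -/
theorem exists_finite_sup_range_of_differential [CharZero K] (r : ℕ) (b : ℕ → LaurentSeries K)
    (hb : b r ≠ 0) (P : LaurentSeries K →ₗ[K] LaurentSeries K)
    (hP : ∀ f, P f = ∑ i ∈ Finset.range (r + 1), (derivative K ^ i) (b i * f)) :
    ∃ W : Submodule K (LaurentSeries K), FiniteDimensional K W ∧ W ⊔ LinearMap.range P = ⊤ := by
  classical
  obtain ⟨q, hq, hmax⟩ := Finset.exists_max_image
    ((Finset.range (r + 1)).filter fun i => b i ≠ 0) (fun i => (i : ℤ) - (b i).order)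
    ⟨r, by simp [hb]⟩
  rw [Finset.mem_filter] at hq
  -- The largest drop in order that a term f ↦ ∂^i (b_i f) can cause, attained at i = q.
  set s : ℤ := q - (b q).order with hs
  have hb0 : ∀ i ∈ Finset.range (r + 1), ∀ l < (i : ℤ) - s, (b i).coeff l = 0 := by
    intro i hi l hl
    by_cases h0 : b i = 0
    · rw [h0, HahnSeries.coeff_zero]
    · have := hmax i (Finset.mem_filter.mpr ⟨hi, h0⟩)
      exact HahnSeries.coeff_eq_zero_of_lt_order (by linarith)
  have hcq : (b q).coeff (q - s) ≠ 0 := by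
    rw [show (q : ℤ) - s = (b q).order by rw [hs]; ring]
    exact fun h => hq.2 (HahnSeries.coeff_order_eq_zero.mp h)
  -- The indicial polynomial: ψ(m) is the coefficient of t^(m-s) in P(t^m).
  set ψ : Polynomial K := ∑ i ∈ Finset.range (r + 1), Polynomial.C ((b i).coeff (i - s)) *
    (descPochhammer K i).comp (Polynomial.X + Polynomial.C ((i - s : ℤ) : K)) with hψ
  have hdeg : ∀ i : ℕ, ((descPochhammer K i).comp
      (Polynomial.X + Polynomial.C ((i - s : ℤ) : K))).natDegree = i := by
    intro i
    rw [Polynomial.natDegree_comp, Polynomial.natDegree_X_add_C, mul_one, descPochhammer_natDegree]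
  have hmonic : ∀ i : ℕ, ((descPochhammer K i).comp
      (Polynomial.X + Polynomial.C ((i - s : ℤ) : K))).Monic := fun i =>
    (monic_descPochhammer K i).comp_X_add_C _
  -- The i-th summand is a scalar times a monic polynomial of degree i, so the last nonzero one
  -- cannot cancel; q shows that there is one.
  have hψ0 : ψ ≠ 0 := by
    obtain ⟨p, hp, hpmax⟩ := Finset.exists_max_image
      ((Finset.range (r + 1)).filter fun i => (b i).coeff (i - s) ≠ 0) id
      ⟨q, Finset.mem_filter.mpr ⟨hq.1, hcq⟩⟩
    rw [Finset.mem_filter] at hp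
    intro h
    have h1 : ψ.coeff p = (b p).coeff (p - s) := by
      rw [hψ, Polynomial.finsetSum_coeff, Finset.sum_eq_single p]
      · rw [Polynomial.coeff_C_mul]
        have := (hmonic p).coeff_natDegree
        rw [hdeg] at this
        rw [this, mul_one]
      · intro i hi hip
        rw [Polynomial.coeff_C_mul]
        rcases lt_or_gt_of_ne hip with hlt | hgt
        · rw [Polynomial.coeff_eq_zero_of_natDegree_lt (by rwa [hdeg]), mul_zero]
        · by_cases h0 : (b i).coeff (i - s) = 0
          · rw [h0, zero_mul]
          · exact absurd (hpmax i (Finset.mem_filter.mpr ⟨hi, h0⟩)) (not_le.mpr hgt)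
      · exact fun h' => absurd hp.1 h'
    rw [h, Polynomial.coeff_zero] at h1
    exact hp.2 h1.symm
  refine exists_finite_sup_range_of_indicial P (fun m => ψ.eval (m : K)) s ?_ ?_
  · intro m f hf
    have hmul := fun i hi => coeff_mul_of_coeff_eq_zero (hb0 i hi) hf
    constructor
    · intro l hl
      rw [hP, HahnSeries.coeff_sum]
      refine Finset.sum_eq_zero fun i hi => ?_
      rw [derivative_pow_coeff, (hmul i hi).1 _ (by linarith), mul_zero]
    · rw [hP, HahnSeries.coeff_sum, hψ, Polynomial.eval_finsetSum, Finset.sum_mul]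
      refine Finset.sum_congr rfl fun i hi => ?_
      have e : m - s + i = (i - s) + m := by ring
      rw [derivative_pow_coeff, e, (hmul i hi).2, Polynomial.eval_mul, Polynomial.eval_C,
        Polynomial.eval_comp, Polynomial.eval_add, Polynomial.eval_X, Polynomial.eval_C]
      have e' : (m : K) + ((i - s : ℤ) : K) = ((i - s + m : ℤ) : K) := by push_cast; ring
      rw [e']
      ring
  · refine ((ψ.roots.toFinset.finite_toSet).preimage (f := fun m : ℤ => (m : K))
      (Int.cast_injective.injOn)).subset fun m hm => ?_
    simpa [hψ0] using hm

theorem eq_C_of_derivative_eq_zero [CharZero K] {f : LaurentSeries K} (hf : derivative K f = 0) :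
    f = HahnSeries.C (f.coeff 0) := by
  ext m
  by_cases hm : m = 0
  · simp [hm]
  · have h := congrArg (fun g => HahnSeries.coeff g (m - 1)) hf
    simp only [derivative_apply, hasseDeriv_coeff, HahnSeries.coeff_zero, Nat.cast_one,
      sub_add_cancel, Ring.choose_one_right] at h
    rw [← Int.cast_smul_eq_zsmul K, smul_eq_zero] at h
    rw [HahnSeries.C_apply, HahnSeries.coeff_single_of_ne hm]
    exact h.resolve_left (by exact_mod_cast hm)

/-! ### Connections in one variable: finiteness of kernel and cokernel. -/

section Connection

variable {A : Type v} [AddCommGroup A] [Module K A] [Module (LaurentSeries K) A]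
  {D : A →ₗ[K] A}

/-- Integration by parts: D (f • D^i e) = f' • D^i e + f • D^(i+1) e, so modulo the range each D
moves from e to f at the cost of a sign. -/
theorem smul_pow_sub_mem_range
    (hD : ∀ (f : LaurentSeries K) (a : A), D (f • a) = derivative K f • a + f • D a)
    (e : A) (i : ℕ) (f : LaurentSeries K) :
    f • (D ^ i) e - (derivative K ^ i) ((-1) ^ i * f) • e ∈ LinearMap.range D := by
  induction i generalizing f with
  | zero => simp
  | succ i ih =>
    have h1 := ih (-derivative K f)
    have h2 : D (f • (D ^ i) e) ∈ LinearMap.range D := ⟨_, rfl⟩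
    have h3 : (derivative K ^ (i + 1)) ((-1) ^ (i + 1) * f) =
        (derivative K ^ i) ((-1) ^ i * (-derivative K f)) := by
      rw [pow_succ (derivative K), Module.End.mul_apply]
      congr 1
      rcases neg_one_pow_eq_or (LaurentSeries K) i with h | h <;> rw [pow_succ, h] <;>
        simp only [mul_neg, neg_neg, one_mul, neg_mul, mul_one, map_neg]
    rw [h3]
    have h4 := Submodule.add_mem _ h1 h2
    rw [hD] at h4
    rw [pow_succ' D, Module.End.mul_apply]
    convert h4 using 1
    rw [neg_smul]
    abel

variable [IsScalarTower K (LaurentSeries K) A]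

/-- Express a horizontal vector in a maximal K((t))-independent set of horizontal vectors. Applying
D shows that the coefficients have zero derivative, hence lie in K. -/
theorem finite_ker_of_leibniz [CharZero K] [FiniteDimensional (LaurentSeries K) A]
    (hD : ∀ (f : LaurentSeries K) (a : A), D (f • a) = derivative K f • a + f • D a) :
    FiniteDimensional K (LinearMap.ker D) := by
  obtain ⟨s, hs, hspan, hli⟩ := exists_linearIndependent (LaurentSeries K) (LinearMap.ker D : Set A)
  have hfin : s.Finite := hli.setFinite
  have : LinearMap.ker D ≤ Submodule.span K s := by
    intro v hv
    have hv' : v ∈ Submodule.span (LaurentSeries K) (Set.range ((↑) : s → A)) := by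
      rw [Subtype.range_coe, hspan]
      exact Submodule.subset_span hv
    have := hfin.fintype
    obtain ⟨f, rfl⟩ := (Submodule.mem_span_range_iff_exists_fun _).mp hv'
    have h0 : ∑ i : s, derivative K (f i) • (i : A) = 0 := by
      rw [← LinearMap.mem_ker.mp hv, map_sum]
      refine Finset.sum_congr rfl fun i _ => ?_
      rw [hD, LinearMap.mem_ker.mp (hs i.2), smul_zero, add_zero]
    refine Submodule.sum_mem _ fun i _ => ?_
    have hi := eq_C_of_derivative_eq_zero
      ((Fintype.linearIndependent_iff.mp hli) (fun i => derivative K (f i)) h0 i)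
    have e : f i • (i : A) = (f i).coeff 0 • (i : A) := by
      conv_lhs => rw [hi, ← mul_one (HahnSeries.C _), HahnSeries.C_mul_eq_smul, smul_assoc, one_smul]
    rw [e]
    exact Submodule.smul_mem _ _ (Submodule.subset_span i.2)
  have hF : FiniteDimensional K (Submodule.span K s) := FiniteDimensional.span_of_finite K hfin
  exact Submodule.finiteDimensional_of_le this

-- Take a maximal D-stable U with finite-dimensional image in A / D(A). If e ∉ U, the spaces U + ⟨e,
-- De, …⟩ stabilize, giving a relation D^r e = u + ∑ a_i D^i e with u ∈ U. Multiplied by f and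
-- integrated by parts, it puts P(f) • e in the image of U for a nonzero scalar operator P. As P has
-- finite cokernel, the orbit of e can be adjoined to U, against maximality.
set_option maxHeartbeats 1000000 in
theorem finite_coker_of_leibniz [CharZero K] [FiniteDimensional (LaurentSeries K) A]
    (hD : ∀ (f : LaurentSeries K) (a : A), D (f • a) = derivative K f • a + f • D a) :
    FiniteDimensional K (A ⧸ LinearMap.range D) := by
  let good : Submodule (LaurentSeries K) A → Prop := fun U => (∀ x ∈ U, D x ∈ U) ∧
    ∃ W : Submodule K A, FiniteDimensional K W ∧ U.restrictScalars K ≤ W ⊔ LinearMap.range D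
  have hbot : good ⊥ := ⟨by simp, ⊥, inferInstance, by simp⟩
  obtain ⟨U, ⟨hUD, W, hWfin, hUW⟩, hUmax⟩ :=
    WellFounded.has_min (wellFounded_gt (α := Submodule (LaurentSeries K) A)) {U | good U} ⟨_, hbot⟩
  have htop : U = ⊤ := by
    by_contra hne
    obtain ⟨e, he⟩ : ∃ e, e ∉ U := by
      by_contra! h
      exact hne (eq_top_iff.mpr fun x _ => h x)
    obtain ⟨S, hS0, hS⟩ : ∃ S : ℕ → Submodule (LaurentSeries K) A, S 0 = U ∧
        ∀ r, S (r + 1) = S r ⊔ Submodule.span (LaurentSeries K) {(D ^ r) e} :=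
      ⟨fun r => Nat.rec U (fun r V => V ⊔ Submodule.span (LaurentSeries K) {(D ^ r) e}) r,
        rfl, fun _ => rfl⟩
    have hmono : Monotone S := monotone_nat_of_le_succ fun r => by rw [hS]; exact le_sup_left
    have hmem : ∀ r x, x ∈ S (r + 1) → ∃ y ∈ S r, ∃ f : LaurentSeries K, x = y + f • (D ^ r) e := by
      intro r x hx
      rw [hS, Submodule.mem_sup] at hx
      obtain ⟨y, hy, z, hz, rfl⟩ := hx
      obtain ⟨f, rfl⟩ := Submodule.mem_span_singleton.mp hz
      exact ⟨y, hy, f, rfl⟩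
    have hpow : ∀ r, (D ^ r) e ∈ S (r + 1) := fun r => by
      rw [hS]; exact Submodule.mem_sup_right (Submodule.mem_span_singleton_self _)
    have hDS : ∀ r, ∀ x ∈ S r, D x ∈ S (r + 1) := by
      intro r
      induction r with
      | zero => exact fun x hx => hmono (Nat.zero_le 1) (hS0.symm ▸ hUD x (hS0 ▸ hx))
      | succ r ih =>
        intro x hx
        obtain ⟨y, hy, f, rfl⟩ := hmem r x hx
        rw [map_add, hD]
        refine Submodule.add_mem _ (hmono (Nat.le_succ _) (ih y hy)) (Submodule.add_mem _
          (Submodule.smul_mem _ _ (hmono (Nat.le_succ _) (hpow r))) (Submodule.smul_mem _ _ ?_))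
        rw [← Module.End.mul_apply, ← pow_succ']
        exact hpow (r + 1)
    have hexp : ∀ r, ∀ x ∈ S r, ∃ u ∈ U, ∃ a : ℕ → LaurentSeries K,
        x = u + ∑ i ∈ Finset.range r, a i • (D ^ i) e := by
      intro r
      induction r with
      | zero => exact fun x hx => ⟨x, hS0 ▸ hx, 0, by simp⟩
      | succ r ih =>
        intro x hx
        obtain ⟨y, hy, f, rfl⟩ := hmem r x hx
        obtain ⟨u, hu, a, rfl⟩ := ih y hy
        refine ⟨u, hu, Function.update a r f, ?_⟩
        rw [Finset.sum_range_succ, Function.update_self, ← add_assoc]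
        congr 2
        refine Finset.sum_congr rfl fun i hi => ?_
        rw [Function.update_of_ne (Finset.mem_range.mp hi).ne]
    obtain ⟨r, hr⟩ := monotone_stabilizes_iff_noetherian.mpr
      (inferInstance : IsNoetherian (LaurentSeries K) A) ⟨S, hmono⟩
    have hr1 : S (r + 1) = S r := (hr (r + 1) (Nat.le_succ r)).symm
    have hgood : good (S r) := by
      refine ⟨fun x hx => hr1 ▸ hDS r x hx, ?_⟩
      obtain ⟨u, hu, a, hrel⟩ := hexp r ((D ^ r) e) (hr1 ▸ hpow r)
      -- The coefficients of u = D^r e - ∑ a_i D^i e, with the signs from integration by parts; b_r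
      -- = ±1 makes P nonzero.
      let b : ℕ → LaurentSeries K := fun i => (-1) ^ i * (if i = r then 1 else - a i)
      have hbr : b r ≠ 0 := by
        simp only [b, if_true, mul_one]
        exact pow_ne_zero _ (neg_ne_zero.mpr one_ne_zero)
      let P : LaurentSeries K →ₗ[K] LaurentSeries K :=
        ∑ i ∈ Finset.range (r + 1), (derivative K ^ i) ∘ₗ mulLeft (b i)
      have hP : ∀ f, P f = ∑ i ∈ Finset.range (r + 1), (derivative K ^ i) (b i * f) := by
        intro f
        simp only [P, LinearMap.sum_apply, LinearMap.comp_apply]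
        rfl
      obtain ⟨W', hW', hW'top⟩ := exists_finite_sup_range_of_differential r b hbr P hP
      have hPmem : ∀ f, P f • e ∈ W ⊔ LinearMap.range D := by
        intro f
        have h1 : ∑ i ∈ Finset.range (r + 1),
            ((if i = r then 1 else - a i) * f) • (D ^ i) e = f • u := by
          rw [Finset.sum_range_succ, if_pos rfl, one_mul]
          have : ∑ i ∈ Finset.range r, ((if i = r then 1 else - a i) * f) • (D ^ i) e =
              - (f • ∑ i ∈ Finset.range r, a i • (D ^ i) e) := by
            rw [Finset.smul_sum, ← Finset.sum_neg_distrib]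
            refine Finset.sum_congr rfl fun i hi => ?_
            rw [if_neg (Finset.mem_range.mp hi).ne, smul_smul, mul_comm f, neg_mul, neg_smul]
          rw [this, hrel, smul_add]
          abel
        have h2 : f • u - P f • e ∈ LinearMap.range D := by
          rw [← h1, hP, Finset.sum_smul, ← Finset.sum_sub_distrib]
          refine Submodule.sum_mem _ fun i _ => ?_
          have := smul_pow_sub_mem_range hD e i ((if i = r then 1 else - a i) * f)
          rwa [← mul_assoc] at this
        have h3 : f • u ∈ W ⊔ LinearMap.range D := hUW (U.smul_mem f hu)
        have h4 := Submodule.sub_mem _ h3 (Submodule.mem_sup_right h2)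
        rwa [sub_sub_cancel] at h4
      let ev : LaurentSeries K →ₗ[K] A :=
        (LinearMap.toSpanSingleton (LaurentSeries K) A e).restrictScalars K
      have hle : W ⊔ LinearMap.range D ≤ (W ⊔ W'.map ev) ⊔ LinearMap.range D :=
        sup_le_sup_right le_sup_left _
      have hev : ∀ g : LaurentSeries K, g • e ∈ (W ⊔ W'.map ev) ⊔ LinearMap.range D := by
        intro g
        obtain ⟨w, hw, _, ⟨f, rfl⟩, rfl⟩ :=
          Submodule.mem_sup.mp (hW'top ▸ Submodule.mem_top : g ∈ W' ⊔ LinearMap.range P)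
        rw [add_smul]
        refine Submodule.add_mem _ (Submodule.mem_sup_left (Submodule.mem_sup_right ⟨w, hw, rfl⟩)) ?_
        exact hle (hPmem f)
      refine ⟨W ⊔ W'.map ev, inferInstance, ?_⟩
      intro x hx
      obtain ⟨u', hu', a', rfl⟩ := hexp r x hx
      refine Submodule.add_mem _ (hle (hUW hu'))
        (Submodule.sum_mem _ fun i _ => ?_)
      have h1 := smul_pow_sub_mem_range hD e i (a' i)
      have h2 := Submodule.add_mem _ (Submodule.mem_sup_right h1)
        (hev ((derivative K ^ i) ((-1) ^ i * a' i)))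
      rwa [sub_add_cancel] at h2
    refine hUmax (S r) hgood (lt_of_le_of_ne (hS0 ▸ hmono (Nat.zero_le r)) fun h => he ?_)
    -- S r contains e when r > 0; for r = 0, stabilization itself already puts e in U.
    by_cases hr0 : r = 0
    · subst hr0
      have := hpow 0
      rwa [hr1, hS0] at this
    · rw [h]
      exact hmono (Nat.one_le_iff_ne_zero.mpr hr0) (hpow 0)
  have hWtop : W ⊔ LinearMap.range D = ⊤ := by
    rw [eq_top_iff]
    intro x _
    exact hUW (by rw [htop]; trivial)
  refine Module.Finite.of_surjective ((LinearMap.range D).mkQ ∘ₗ W.subtype) ?_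
  rw [← LinearMap.range_eq_top, LinearMap.range_comp, Submodule.range_subtype,
    Submodule.map_mkQ_eq_top, sup_comm]
  exact hWtop

end Connection

end LaurentSeries

/-! ### Finiteness of homology in a three-term sequence. -/

section Homology

variable {k : Type u} [Field k]

/-- The kernel of `δ` is spanned by its range and a finite-dimensional subspace. -/
def LinearMap.HasFiniteHomology {C : Type*} [AddCommGroup C] [Module k C] (δ : C →ₗ[k] C) : Prop :=
  ∃ W : Submodule k C, FiniteDimensional k W ∧ LinearMap.ker δ ≤ W ⊔ LinearMap.range δ

/-- `hfg` is exactness of H(X) → H(Y) → H(Z) in the middle. Cocycles of Y split into finitely many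
lifts of classes in Z and cocycles coming from X up to boundaries. -/
theorem LinearMap.HasFiniteHomology.of_exact {X Y Z : Type*} [AddCommGroup X] [Module k X]
    [AddCommGroup Y] [Module k Y] [AddCommGroup Z] [Module k Z] {δX : X →ₗ[k] X} {δY : Y →ₗ[k] Y}
    {δZ : Z →ₗ[k] Z} (f : X →ₗ[k] Y) (g : Y →ₗ[k] Z) (hf : ∀ x, δY (f x) = f (δX x))
    (hg : ∀ y, g (δY y) = δZ (g y))
    (hfg : ∀ y, δY y = 0 → g y ∈ LinearMap.range δZ →
      ∃ x, δX x = 0 ∧ y - f x ∈ LinearMap.range δY)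
    (hX : δX.HasFiniteHomology) (hZ : δZ.HasFiniteHomology) : δY.HasFiniteHomology := by
  obtain ⟨WX, _, hWX⟩ := hX
  obtain ⟨WZ, _, hWZ⟩ := hZ
  let φ : LinearMap.ker δY →ₗ[k] Z ⧸ LinearMap.range δZ :=
    (LinearMap.range δZ).mkQ ∘ₗ g ∘ₗ (LinearMap.ker δY).subtype
  have hφ : LinearMap.range φ ≤ WZ.map (LinearMap.range δZ).mkQ := by
    rintro _ ⟨y, rfl⟩
    have hy : g y ∈ LinearMap.ker δZ := by
      rw [LinearMap.mem_ker, ← hg, LinearMap.mem_ker.mp y.2, map_zero]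
    obtain ⟨w, hw, _, ⟨z, rfl⟩, h⟩ := Submodule.mem_sup.mp (hWZ hy)
    refine ⟨w, hw, ?_⟩
    change _ = (LinearMap.range δZ).mkQ (g y)
    rw [← h, map_add]
    simp
  have : FiniteDimensional k (LinearMap.range φ) := Submodule.finiteDimensional_of_le hφ
  obtain ⟨s, hs⟩ := φ.rangeRestrict.exists_rightInverse_of_surjective φ.range_rangeRestrict
  refine ⟨(LinearMap.range s).map (LinearMap.ker δY).subtype ⊔ WX.map f, inferInstance, ?_⟩
  intro y hy
  let y' : LinearMap.ker δY := ⟨y, hy⟩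
  let t : LinearMap.ker δY := s (φ.rangeRestrict y')
  have ht : φ t = φ y' := congrArg Subtype.val (LinearMap.congr_fun hs (φ.rangeRestrict y'))
  have h0 : g ((y' - t : LinearMap.ker δY) : Y) ∈ LinearMap.range δZ := by
    rw [← Submodule.Quotient.mk_eq_zero]
    change φ (y' - t) = 0
    rw [map_sub, ht, sub_self]
  obtain ⟨x, hx, hyx⟩ := hfg _ (LinearMap.mem_ker.mp (y' - t).2) h0
  obtain ⟨w, hw, _, ⟨z, rfl⟩, rfl⟩ := Submodule.mem_sup.mp (hWX hx)
  have e : y = (t : Y) + f w + (δY (f z) + ((y' - t : LinearMap.ker δY) - f (w + δX z))) := by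
    rw [hf, map_add, Submodule.coe_sub]
    change y = _ + _ + (_ + (y - _ - _))
    abel
  rw [e]
  exact Submodule.add_mem_sup
    (Submodule.add_mem_sup ⟨t, ⟨_, rfl⟩, rfl⟩ ⟨w, hw, rfl⟩)
    (Submodule.add_mem _ ⟨_, rfl⟩ hyx)

end Homology

/-! ### The Koszul complex as an iterated cone. -/

section Koszul

variable {k : Type u} [Field k] {n : ℕ} {A : Type v}

/-- A subset of `{1, …, n}` as a subset of `{1, …, n + 1}`. -/
def lowFinset (I : Finset (Fin n)) : Finset (Fin (n + 1)) := I.map Fin.castSuccEmb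

/-- A subset of `{1, …, n}`, enlarged by the element `n + 1`. -/
def highFinset (I : Finset (Fin n)) : Finset (Fin (n + 1)) := insert (Fin.last n) (lowFinset I)

theorem last_notMem_lowFinset (I : Finset (Fin n)) : Fin.last n ∉ lowFinset I := by
  simp [lowFinset, Fin.castSucc_ne_last]

theorem card_filter_lowFinset (I : Finset (Fin n)) (j : Fin n) :
    ((lowFinset I).filter (· < j.castSucc)).card = (I.filter (· < j)).card := by
  rw [lowFinset, Finset.filter_map, Finset.card_map]
  rfl

theorem card_filter_highFinset (I : Finset (Fin n)) (j : Fin n) :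
    ((highFinset I).filter (· < j.castSucc)).card = (I.filter (· < j)).card := by
  rw [highFinset, Finset.filter_insert, if_neg (not_lt.mpr (Fin.le_last _)), card_filter_lowFinset]

theorem card_filter_last (I : Finset (Fin n)) :
    ((highFinset I).filter (· < Fin.last n)).card = I.card := by
  rw [highFinset, Finset.filter_insert, if_neg (lt_irrefl _), Finset.filter_true_of_mem, lowFinset,
    Finset.card_map]
  intro x hx
  exact lt_of_le_of_ne (Fin.le_last x) fun h => last_notMem_lowFinset I (h ▸ hx)

theorem lowFinset_erase (I : Finset (Fin n)) (j : Fin n) :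
    (lowFinset I).erase j.castSucc = lowFinset (I.erase j) :=
  (Finset.map_erase Fin.castSuccEmb I j).symm

theorem highFinset_erase (I : Finset (Fin n)) (j : Fin n) :
    (highFinset I).erase j.castSucc = highFinset (I.erase j) := by
  rw [highFinset, Finset.erase_insert_of_ne (Fin.castSucc_ne_last j).symm, lowFinset_erase]
  rfl

theorem low_or_high (J : Finset (Fin (n + 1))) : (∃ I, J = lowFinset I) ∨ ∃ I, J = highFinset I := by
  have key : ∀ J : Finset (Fin (n + 1)), Fin.last n ∉ J →
      J = lowFinset (Finset.univ.filter fun i => i.castSucc ∈ J) := by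
    intro J hJ
    ext x
    induction x using Fin.lastCases with
    | last => simp [hJ, last_notMem_lowFinset]
    | cast i => simp [lowFinset]
  by_cases h : Fin.last n ∈ J
  · refine Or.inr ⟨Finset.univ.filter fun i => i.castSucc ∈ J.erase (Fin.last n), ?_⟩
    rw [highFinset, ← key _ (Finset.notMem_erase (Fin.last n) J), Finset.insert_erase h]
  · exact Or.inl ⟨_, key J h⟩

theorem ext_low_high {y z : Finset (Fin (n + 1)) → A} (hl : ∀ I, y (lowFinset I) = z (lowFinset I))
    (hh : ∀ I, y (highFinset I) = z (highFinset I)) : y = z := by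
  funext J
  obtain ⟨I, rfl⟩ | ⟨I, rfl⟩ := low_or_high J
  exacts [hl I, hh I]

/-- The family with given restrictions to the subsets without and with the last element. -/
def joinParts (x y : Finset (Fin n) → A) : Finset (Fin (n + 1)) → A := fun J =>
  if Fin.last n ∈ J then y (Finset.univ.filter fun i => i.castSucc ∈ J)
  else x (Finset.univ.filter fun i => i.castSucc ∈ J)

theorem joinParts_low (x y : Finset (Fin n) → A) (I : Finset (Fin n)) :
    joinParts x y (lowFinset I) = x I := by
  rw [joinParts, if_neg (last_notMem_lowFinset I)]
  congr
  ext i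
  simp [lowFinset]

theorem joinParts_high (x y : Finset (Fin n) → A) (I : Finset (Fin n)) :
    joinParts x y (highFinset I) = y I := by
  rw [joinParts, if_pos (show Fin.last n ∈ highFinset I from Finset.mem_insert_self _ _)]
  congr
  ext i
  simp [highFinset, lowFinset, Fin.castSucc_ne_last]

variable [AddCommGroup A] [Module k A]

/-- The total differential of the Koszul complex of operators `D_1, …, D_n` on `A`, on families
`(y_J)` of elements of `A` indexed by the subsets of `{1, …, n}`. -/
def koszul (D : Fin n → A →ₗ[k] A) : (Finset (Fin n) → A) →ₗ[k] (Finset (Fin n) → A) :=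
  LinearMap.pi fun J => ∑ j ∈ J, (-1 : k) ^ (J.filter (· < j)).card •
    (D j ∘ₗ LinearMap.proj (J.erase j))

theorem koszul_apply (D : Fin n → A →ₗ[k] A) (y : Finset (Fin n) → A) (J : Finset (Fin n)) :
    koszul D y J = ∑ j ∈ J, (-1 : k) ^ (J.filter (· < j)).card • D j (y (J.erase j)) := by
  simp [koszul]

theorem koszul_comp {B : Type*} [AddCommGroup B] [Module k B] {D : Fin n → A →ₗ[k] A}
    {D' : Fin n → B →ₗ[k] B} (f : A →ₗ[k] B) (hf : ∀ j a, f (D j a) = D' j (f a))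
    (y : Finset (Fin n) → A) : koszul D' (f ∘ y) = f ∘ koszul D y := by
  ext J
  simp only [koszul_apply, Function.comp_apply, map_sum, map_smul, hf]

variable (D : Fin (n + 1) → A →ₗ[k] A)

theorem koszul_low (y : Finset (Fin (n + 1)) → A) (I : Finset (Fin n)) :
    koszul D y (lowFinset I) =
      koszul (fun j => D j.castSucc) (fun I => y (lowFinset I)) I := by
  rw [koszul_apply, koszul_apply, lowFinset, Finset.sum_map]
  refine Finset.sum_congr rfl fun j _ => ?_
  change (-1 : k) ^ ((lowFinset I).filter (· < j.castSucc)).card •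
    D j.castSucc (y ((lowFinset I).erase j.castSucc)) = _
  rw [card_filter_lowFinset, lowFinset_erase]

/-- The last index exceeds all of I, whence the sign. With `koszul_low` this is the cone of the last
operator, mapping low parts to high parts. -/
theorem koszul_high (y : Finset (Fin (n + 1)) → A) (I : Finset (Fin n)) :
    koszul D y (highFinset I) =
      koszul (fun j => D j.castSucc) (fun I => y (highFinset I)) I +
        (-1 : k) ^ I.card • D (Fin.last n) (y (lowFinset I)) := by
  rw [koszul_apply, koszul_apply]
  conv_lhs => rw [highFinset, Finset.sum_insert (last_notMem_lowFinset I), ← highFinset, add_comm]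
  congr 1
  · rw [lowFinset, Finset.sum_map]
    refine Finset.sum_congr rfl fun j _ => ?_
    change (-1 : k) ^ ((highFinset I).filter (· < j.castSucc)).card •
      D j.castSucc (y ((highFinset I).erase j.castSucc)) = _
    rw [card_filter_highFinset, highFinset_erase]
  · rw [card_filter_last, highFinset, Finset.erase_insert (last_notMem_lowFinset I)]

/-- The sign operator `y_I ↦ (-1)^|I| y_I`. -/
def signFamily (y : Finset (Fin n) → A) : Finset (Fin n) → A := fun I => (-1 : k) ^ I.card • y I

theorem koszul_signFamily (D : Fin n → A →ₗ[k] A) (y : Finset (Fin n) → A) :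
    koszul D (signFamily (k := k) y) = - signFamily (k := k) (koszul D y) := by
  funext J
  simp only [Pi.neg_apply, signFamily, koszul_apply, Finset.smul_sum, ← Finset.sum_neg_distrib]
  refine Finset.sum_congr rfl fun j hj => ?_
  rw [map_smul, smul_comm, ← neg_smul, Finset.card_erase_of_mem hj]
  congr 1
  obtain ⟨m, hm⟩ := Nat.exists_eq_succ_of_ne_zero (Finset.card_pos.mpr ⟨j, hj⟩).ne'
  rw [hm, Nat.succ_sub_one, pow_succ]
  ring

/-- In the cone decomposition the diagonal terms vanish by induction. The two mixed terms cancel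
because the last operator commutes with the smaller differential while `signFamily` anticommutes
with it. -/
theorem koszul_koszul (n : ℕ) (D : Fin n → A →ₗ[k] A)
    (hD : ∀ i j a, D i (D j a) = D j (D i a)) (y : Finset (Fin n) → A) :
    koszul D (koszul D y) = 0 := by
  induction n with
  | zero =>
    funext J
    rw [koszul_apply, Finset.eq_empty_of_isEmpty J, Finset.sum_empty]
    rfl
  | succ n ih =>
    have ih' := ih (fun j => D j.castSucc) fun i j a => hD _ _ _
    refine ext_low_high (fun I => ?_) (fun I => ?_)
    · rw [koszul_low]
      simp only [koszul_low]
      exact congrFun (ih' _) I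
    · rw [koszul_high, koszul_low]
      simp only [koszul_high]
      have e : (fun I => koszul (fun j => D j.castSucc) (fun I => y (highFinset I)) I +
          (-1 : k) ^ I.card • D (Fin.last n) (y (lowFinset I))) =
          koszul (fun j => D j.castSucc) (fun I => y (highFinset I)) +
            signFamily (k := k) (D (Fin.last n) ∘ fun I => y (lowFinset I)) := rfl
      rw [e, map_add, ih', koszul_signFamily, koszul_comp (D (Fin.last n)) fun j a => hD _ _ _]
      simp [signFamily]

/-- The Koszul complex of `D_1, …, D_{n+1}` is the cone of `D_{n+1}` on the Koszul complex of
`D_1, …, D_n`, hence is controlled by the kernel and the cokernel of `D_{n+1}`. -/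
theorem koszul_hasFiniteHomology_succ (hD : ∀ i j a, D i (D j a) = D j (D i a))
    {A' A'' : Type*} [AddCommGroup A'] [Module k A'] [AddCommGroup A''] [Module k A'']
    (D' : Fin n → A' →ₗ[k] A') (D'' : Fin n → A'' →ₗ[k] A'')
    (ι : A' →ₗ[k] A) (hι : Function.Injective ι)
    (hιr : LinearMap.range ι = LinearMap.ker (D (Fin.last n)))
    (hιD : ∀ j a, ι (D' j a) = D j.castSucc (ι a))
    (π : A →ₗ[k] A'') (hπ : Function.Surjective π)
    (hπk : LinearMap.ker π = LinearMap.range (D (Fin.last n)))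
    (hπD : ∀ j a, π (D j.castSucc a) = D'' j (π a))
    (h' : (koszul D').HasFiniteHomology) (h'' : (koszul D'').HasFiniteHomology) :
    (koszul D).HasFiniteHomology := by
  let f : (Finset (Fin n) → A') →ₗ[k] (Finset (Fin (n + 1)) → A) :=
    { toFun := fun x => joinParts (ι ∘ x) 0
      map_add' := fun x y => ext_low_high
        (fun I => by simp [joinParts_low]) (fun I => by simp [joinParts_high])
      map_smul' := fun c x => ext_low_high
        (fun I => by simp [joinParts_low]) (fun I => by simp [joinParts_high]) }
  have hfl : ∀ x I, f x (lowFinset I) = ι (x I) := fun x I => joinParts_low _ _ I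
  have hfh : ∀ x I, f x (highFinset I) = 0 := fun x I => joinParts_high _ _ I
  let g : (Finset (Fin (n + 1)) → A) →ₗ[k] (Finset (Fin n) → A'') :=
    LinearMap.pi fun I => π ∘ₗ LinearMap.proj (highFinset I)
  have hN : ∀ a, D (Fin.last n) (ι a) = 0 := fun a => by
    rw [← LinearMap.mem_ker, ← hιr]
    exact ⟨a, rfl⟩
  have hπN : ∀ a, π (D (Fin.last n) a) = 0 := fun a => by
    rw [← LinearMap.mem_ker, hπk]
    exact ⟨a, rfl⟩
  refine LinearMap.HasFiniteHomology.of_exact f g ?_ ?_ ?_ h' h''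
  · intro x
    refine ext_low_high (fun I => ?_) (fun I => ?_)
    · rw [koszul_low, hfl]
      simp only [hfl]
      exact congrFun (koszul_comp ι hιD x) I
    · rw [koszul_high, hfh]
      simp only [hfl, hfh, hN, smul_zero, add_zero]
      exact congrFun (map_zero (koszul fun j => D j.castSucc)) I
  · intro y
    funext I
    change π (koszul D y (highFinset I)) = koszul D'' (π ∘ fun I => y (highFinset I)) I
    rw [koszul_high, map_add, map_smul, hπN, smul_zero, add_zero, koszul_comp π hπD]
    rfl
  · rintro y hy ⟨z, hz⟩
    choose u hu using fun I => hπ (z I)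
    have h1 : ∀ I, y (highFinset I) - koszul (fun j => D j.castSucc) u I ∈
        LinearMap.range (D (Fin.last n)) := by
      intro I
      rw [← hπk, LinearMap.mem_ker, map_sub, sub_eq_zero]
      have e : z = π ∘ u := funext fun I => (hu I).symm
      rw [e, koszul_comp π hπD] at hz
      exact (congrFun hz I).symm
    choose v hv using h1
    -- The sign on v undoes the one in `koszul_high`, so that y - koszul D w has zero high part.
    let w : Finset (Fin (n + 1)) → A := joinParts (signFamily (k := k) v) u
    let y' := y - koszul D w
    have hy' : koszul D y' = 0 := by rw [map_sub, hy, koszul_koszul _ _ hD, sub_zero]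
    have hy'h : ∀ I, y' (highFinset I) = 0 := by
      intro I
      simp only [y', Pi.sub_apply, koszul_high, w, joinParts_high, joinParts_low]
      rw [signFamily, map_smul, hv, smul_smul, ← mul_pow]
      simp
    -- Once the high part is zero, the high component of the cocycle equation says that the last
    -- operator kills the low part.
    have hy'l : ∀ I, y' (lowFinset I) ∈ LinearMap.range ι := by
      intro I
      have := congrFun hy' (highFinset I)
      rw [koszul_high] at this
      simp only [hy'h] at this
      have e0 : koszul (fun j => D j.castSucc) (fun _ : Finset (Fin n) => (0 : A)) I = 0 :=
        congrFun (map_zero (koszul fun j => D j.castSucc)) I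
      rw [e0, zero_add, Pi.zero_apply, smul_eq_zero] at this
      rw [hιr, LinearMap.mem_ker]
      exact this.resolve_left (pow_ne_zero _ (neg_ne_zero.mpr one_ne_zero))
    choose x hx using hy'l
    refine ⟨x, ?_, w, ?_⟩
    · funext I
      refine hι ?_
      have := congrFun hy' (lowFinset I)
      rw [koszul_low] at this
      have e : (fun I => y' (lowFinset I)) = ι ∘ x := funext fun I => (hx I).symm
      rw [e, koszul_comp ι hιD] at this
      simpa using this
    · have e : f x = y' := ext_low_high (fun I => by rw [hfl, hx]) (fun I => by rw [hfh, hy'h])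
      rw [e]
      simp [y']

end Koszul

/-! ### Induction on the number of variables. -/

namespace HigherLocalField

variable {k : Type u} [Field k]

theorem partialDeriv_last_C (n : ℕ) (x : HigherLocalField k n) :
    partialDeriv k (n + 1) (Fin.last n) ((succRingEquiv k n).symm (HahnSeries.C x)) = 0 := by
  simp only [partialDeriv, Fin.lastCases_last]
  change (succEquiv k n).symm (LaurentSeries.derivative k (HahnSeries.C x)) = 0
  rw [HahnSeries.C_apply, LaurentSeries.derivative_apply, LaurentSeries.hasseDeriv_single]
  simp

theorem partialDeriv_castSucc_C (n : ℕ) (j : Fin n) (x : HigherLocalField k n) :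
    partialDeriv k (n + 1) j.castSucc ((succRingEquiv k n).symm (HahnSeries.C x)) =
      (succRingEquiv k n).symm (HahnSeries.C (partialDeriv k n j x)) := by
  simp only [partialDeriv, Fin.lastCases_castSucc]
  change (succEquiv k n).symm (mapCoeff (partialDeriv k n j) (HahnSeries.C x)) = _
  have h : mapCoeff (partialDeriv k n j) (HahnSeries.C x) =
      HahnSeries.C (partialDeriv k n j x) := by
    ext m
    by_cases hm : m = 0 <;> simp [mapCoeff, HahnSeries.C_apply, hm]
  exact congrArg (succEquiv k n).symm h

theorem partialDeriv_last (n : ℕ) (f : LaurentSeries (HigherLocalField k n)) :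
    partialDeriv k (n + 1) (Fin.last n) ((succRingEquiv k n).symm f) =
      (succRingEquiv k n).symm (LaurentSeries.derivative (HigherLocalField k n) f) := by
  simp only [partialDeriv, Fin.lastCases_last]
  rfl

theorem finite_zero : Module.Finite k (HigherLocalField k 0) :=
  Module.Finite.of_surjective (LinearMap.toSpanSingleton k _ (1 : HigherLocalField k 0)) fun x =>
    ⟨x, mul_one (x : k)⟩

/-- A varies inside the induction because the hypothesis is applied to the kernel and cokernel of
the last operator. Commutation makes the other operators act on both. -/
theorem koszul_hasFiniteHomology [CharZero k] (n : ℕ) :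
    ∀ {A : Type v} [AddCommGroup A] [Module k A] [Module (HigherLocalField k n) A]
      [IsScalarTower k (HigherLocalField k n) A] [FiniteDimensional (HigherLocalField k n) A]
      (D : Fin n → A →ₗ[k] A)
      (_ : ∀ j (f : HigherLocalField k n) (a : A), D j (f • a) = partialDeriv k n j f • a + f • D j a)
      (_ : ∀ i j a, D i (D j a) = D j (D i a)), (koszul D).HasFiniteHomology := by
  induction n with
  | zero =>
    intro A _ _ _ _ _ D _ _
    have := finite_zero (k := k)
    have : FiniteDimensional k A := Module.Finite.trans (HigherLocalField k 0) A
    exact ⟨⊤, inferInstance, by simp⟩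
  | succ n ih =>
    intro A _ _ _ _ _ D hL hD
    let C' : HigherLocalField k n →+* HigherLocalField k (n + 1) :=
      (succRingEquiv k n).symm.toRingHom.comp HahnSeries.C
    let _ : Module (LaurentSeries (HigherLocalField k n)) A :=
      Module.compHom A (succRingEquiv k n).symm.toRingHom
    -- F_n acts through constant series, which ∂_{n+1} kills; this makes the last operator
    -- F_n-linear.
    let _ : Module (HigherLocalField k n) A := Module.compHom A C'
    have hsmul : ∀ (x : HigherLocalField k n) (a : A), x • a = C' x • a := fun _ _ => rfl
    have hsmul' : ∀ (f : LaurentSeries (HigherLocalField k n)) (a : A),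
      f • a = (succRingEquiv k n).symm f • a := fun _ _ => rfl
    have : IsScalarTower (HigherLocalField k n) (LaurentSeries (HigherLocalField k n)) A := by
      refine ⟨fun x f a => ?_⟩
      rw [← HahnSeries.C_mul_eq_smul, mul_smul]
      rfl
    have : IsScalarTower k (HigherLocalField k n) A := by
      refine ⟨fun c x a => ?_⟩
      rw [hsmul, hsmul, Algebra.smul_def, map_mul, mul_smul]
      exact algebraMap_smul (HigherLocalField k (n + 1)) c (C' x • a)
    have : FiniteDimensional (LaurentSeries (HigherLocalField k n)) A :=
      ‹FiniteDimensional (HigherLocalField k (n + 1)) A›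
    have : CharZero (HigherLocalField k n) :=
      charZero_of_injective_algebraMap (algebraMap k (HigherLocalField k n)).injective
    let N : A →ₗ[HigherLocalField k n] A :=
      { toFun := D (Fin.last n)
        map_add' := map_add _
        map_smul' := fun x a => by
          rw [hsmul, hL]
          change partialDeriv k (n + 1) (Fin.last n)
            ((succRingEquiv k n).symm (HahnSeries.C x)) • a + _ = _
          rw [partialDeriv_last_C, zero_smul, zero_add]
          rfl }
    have hN : ∀ (f : LaurentSeries (HigherLocalField k n)) (a : A),
        N (f • a) = LaurentSeries.derivative (HigherLocalField k n) f • a + f • N a := by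
      intro f a
      change D (Fin.last n) ((succRingEquiv k n).symm f • a) = _
      rw [hL, partialDeriv_last]
      rfl
    have hLC : ∀ (j : Fin n) (x : HigherLocalField k n) (a : A),
        D j.castSucc (x • a) = partialDeriv k n j x • a + x • D j.castSucc a := by
      intro j x a
      rw [hsmul, hL]
      change partialDeriv k (n + 1) j.castSucc
        ((succRingEquiv k n).symm (HahnSeries.C x)) • a + _ = _
      rw [partialDeriv_castSucc_C]
      rfl
    have := LaurentSeries.finite_ker_of_leibniz hN
    have := LaurentSeries.finite_coker_of_leibniz hN
    let D' : Fin n → LinearMap.ker N →ₗ[k] LinearMap.ker N := fun j =>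
      LinearMap.restrict (p := (LinearMap.ker N).restrictScalars k)
        (q := (LinearMap.ker N).restrictScalars k) (D j.castSucc) fun a ha => by
          change D _ (D _ a) = 0
          rw [hD, show D (Fin.last n) a = 0 from ha, map_zero]
    let D'' : Fin n → (A ⧸ LinearMap.range N) →ₗ[k] (A ⧸ LinearMap.range N) := fun j =>
      Submodule.mapQ ((LinearMap.range N).restrictScalars k)
        ((LinearMap.range N).restrictScalars k) (D j.castSucc) (by
          rintro _ ⟨a, rfl⟩
          exact ⟨D j.castSucc a, hD _ _ _⟩)
    let ι : LinearMap.ker N →ₗ[k] A :=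
      { toFun := Subtype.val
        map_add' := fun _ _ => rfl
        map_smul' := fun _ _ => rfl }
    let π : A →ₗ[k] A ⧸ LinearMap.range N :=
      { toFun := Submodule.Quotient.mk
        map_add' := fun _ _ => rfl
        map_smul' := fun _ _ => rfl }
    have hι : LinearMap.range ι = LinearMap.ker (D (Fin.last n)) := by
      ext a
      exact ⟨fun ⟨b, hb⟩ => hb ▸ b.2, fun ha => ⟨⟨a, ha⟩, rfl⟩⟩
    have hπ : LinearMap.ker π = LinearMap.range (D (Fin.last n)) := by
      ext a
      exact Submodule.Quotient.mk_eq_zero (LinearMap.range N)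
    have hιD : ∀ j a, ι (D' j a) = D j.castSucc (ι a) := fun _ _ => rfl
    have hπD : ∀ j a, π (D j.castSucc a) = D'' j (π a) := fun _ _ => rfl
    have hπs : Function.Surjective π := Submodule.Quotient.mk_surjective _
    refine koszul_hasFiniteHomology_succ D hD D' D'' ι Subtype.val_injective hι hιD π hπs hπ hπD
      (ih D' ?_ ?_) (ih D'' ?_ ?_)
    · intro j f a
      exact Subtype.ext (hLC j f a)
    · intro i j a
      exact Subtype.ext (hD _ _ _)
    · intro j f a
      induction a using Submodule.Quotient.induction_on with
      | _ a => exact congrArg (Submodule.Quotient.mk (p := LinearMap.range N)) (hLC j f a)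
    · intro i j a
      induction a using Submodule.Quotient.induction_on with
      | _ a => exact congrArg (Submodule.Quotient.mk (p := LinearMap.range N)) (hD _ _ a)

end HigherLocalField

/-! ### Signs in ordered exterior products. -/

section ExteriorAlgebra

variable {R M I : Type*} [CommRing R] [AddCommGroup M] [Module R M] [LinearOrder I]

/-- The exterior product of the `v i`, for `i` in a finite set, in increasing order. -/
def ExteriorAlgebra.sortedProd (v : I → M) (s : Finset I) : ExteriorAlgebra R M :=
  ((s.sort (· ≤ ·)).map fun i => ExteriorAlgebra.ι R (v i)).prod

open ExteriorAlgebra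

theorem ExteriorAlgebra.sortedProd_insert (v : I → M) {s : Finset I} {a : I} (ha : ∀ x ∈ s, a < x) :
    sortedProd (R := R) v (insert a s) = ι R (v a) * sortedProd v s := by
  rw [sortedProd, Finset.sort_insert (r := (· ≤ ·)) (fun b hb => (ha b hb).le) fun h => (ha a h).false,
    List.map_cons, List.prod_cons, sortedProd]

theorem ExteriorAlgebra.ι_mul_ι_mul (x y : M) (w : ExteriorAlgebra R M) :
    ι R x * (ι R y * w) = - (ι R y * (ι R x * w)) := by
  rw [← mul_assoc, ← mul_assoc, eq_neg_of_add_eq_zero_left (ι_add_mul_swap x y), neg_mul]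

theorem ExteriorAlgebra.ι_mul_sortedProd_of_mem (v : I → M) (s : Finset I) {j : I} (hj : j ∈ s) :
    ι R (v j) * sortedProd v s = 0 := by
  induction s using Finset.induction_on_min with
  | empty => simp at hj
  | insert a s ha ih =>
    rw [sortedProd_insert v ha]
    rcases Finset.mem_insert.mp hj with rfl | hj
    · rw [← mul_assoc, ι_sq_zero, zero_mul]
    · rw [ι_mul_ι_mul, ih hj, mul_zero, neg_zero]

/-- Moving v j to its place costs one sign for each smaller factor. -/
theorem ExteriorAlgebra.ι_mul_sortedProd_of_notMem (v : I → M) (s : Finset I) {j : I} (hj : j ∉ s) :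
    ι R (v j) * sortedProd v s =
      (-1 : R) ^ (s.filter (· < j)).card • sortedProd v (insert j s) := by
  induction s using Finset.induction_on_min with
  | empty => rw [sortedProd_insert v (by simp)]; simp
  | insert a s ha ih =>
    rw [Finset.mem_insert, not_or] at hj
    rcases lt_or_gt_of_ne hj.1 with h | h
    · have hlt : ∀ x ∈ insert a s, j < x := by
        intro x hx
        rcases Finset.mem_insert.mp hx with rfl | hx
        exacts [h, h.trans (ha x hx)]
      rw [sortedProd_insert v hlt, Finset.filter_false_of_mem fun x hx => (hlt x hx).not_gt]
      simp
    · have hlt : ∀ x ∈ insert j s, a < x := by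
        intro x hx
        rcases Finset.mem_insert.mp hx with rfl | hx
        exacts [h, ha x hx]
      rw [sortedProd_insert v ha, ι_mul_ι_mul, ih hj.2, Finset.insert_comm,
        sortedProd_insert v hlt, Finset.filter_insert, if_pos h, Finset.card_insert_of_notMem
          fun h' => (ha a (Finset.mem_of_mem_filter a h')).false, pow_succ, mul_smul_comm]
      simp

end ExteriorAlgebra

/-! ### Forms in coordinates. -/

namespace HigherLocalField

variable {k : Type u} [Field k] {n : ℕ}

theorem coe_dtBasis (p : ℕ) (I : Set.powersetCard (Fin n) p) :
    (dtBasis k n p I : ExteriorAlgebra (HigherLocalField k n) (OneForms k n)) =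
      ExteriorAlgebra.sortedProd (dt k n) (I : Finset (Fin n)) := by
  rw [dtBasis, exteriorPower.basis_apply, exteriorPower.ιMulti_family,
    exteriorPower.ιMulti_apply_coe, ExteriorAlgebra.ιMulti_apply, ExteriorAlgebra.sortedProd,
    ← Finset.listMap_orderEmbOfFin_finRange _ I.2, List.map_map, List.ofFn_eq_map]
  rfl

theorem repr_wedge_dt {p : ℕ} (j : Fin n) (I : Set.powersetCard (Fin n) p)
    (J : Set.powersetCard (Fin n) (p + 1)) :
    (dtBasis k n (p + 1)).repr (wedge (dt k n j) (dtBasis k n p I)) J =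
      if j ∈ (J : Finset (Fin n)) ∧ (I : Finset (Fin n)) = (J : Finset (Fin n)).erase j then
        (-1) ^ ((J : Finset (Fin n)).filter (· < j)).card else 0 := by
  have hcoe : ((wedge (dt k n j) (dtBasis k n p I) : Forms k n (p + 1)) :
      ExteriorAlgebra (HigherLocalField k n) (OneForms k n)) =
      ExteriorAlgebra.ι _ (dt k n j) * ExteriorAlgebra.sortedProd (dt k n) (I : Finset (Fin n)) := by
    rw [← coe_dtBasis]
    rfl
  by_cases hj : j ∈ (I : Finset (Fin n))
  · rw [ExteriorAlgebra.ι_mul_sortedProd_of_mem _ _ hj] at hcoe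
    rw [show wedge (dt k n j) (dtBasis k n p I) = 0 from Subtype.ext hcoe, map_zero,
      Finsupp.zero_apply, if_neg]
    rintro ⟨_, h⟩
    rw [h] at hj
    exact Finset.notMem_erase j _ hj
  · rw [ExteriorAlgebra.ι_mul_sortedProd_of_notMem _ _ hj] at hcoe
    have hcard : (insert j (I : Finset (Fin n))).card = p + 1 := by
      rw [Finset.card_insert_of_notMem hj, Set.powersetCard.card_eq]
    have h : wedge (dt k n j) (dtBasis k n p I) =
        (-1 : HigherLocalField k n) ^ ((I : Finset (Fin n)).filter (· < j)).card •
          dtBasis k n (p + 1) (Set.powersetCard.ofCard hcard) := by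
      refine Subtype.ext (hcoe.trans ?_)
      rw [Submodule.coe_smul, coe_dtBasis]
      rfl
    rw [h, map_smul, Module.Basis.repr_self, Finsupp.smul_apply, Finsupp.single_apply]
    by_cases hJ : Set.powersetCard.ofCard hcard = J
    · have hJ' : (J : Finset (Fin n)) = insert j (I : Finset (Fin n)) := by rw [← hJ]; rfl
      rw [if_pos hJ, if_pos ⟨hJ' ▸ Finset.mem_insert_self _ _, by rw [hJ', Finset.erase_insert hj]⟩,
        hJ', Finset.filter_insert, if_neg (lt_irrefl j), smul_eq_mul, mul_one]
    · rw [if_neg hJ, smul_zero, if_neg]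
      rintro ⟨h1, h2⟩
      refine hJ (Subtype.ext ?_)
      change insert j (I : Finset (Fin n)) = J
      rw [h2, Finset.insert_erase h1]

theorem repr_d (f : HigherLocalField k n) (j : Fin n) :
    (dt k n).repr (d k n f) j = partialDeriv k n j f := by
  simp [d, Finsupp.single_apply]

end HigherLocalField

open HigherLocalField

/-! ### From the de Rham complex to the Koszul complex. -/

namespace FormalConnection

variable {k : Type u} [Field k] {n : ℕ}
variable {E : Type v} [AddCommGroup E] [Module k E] [Module (HigherLocalField k n) E]

theorem coeff_wedgeRight {p : ℕ} (e : E) (j : Fin n) (I : Set.powersetCard (Fin n) p)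
    (J : Set.powersetCard (Fin n) (p + 1)) :
    coeff J (wedgeRight (dtBasis k n p I) (e ⊗ₜ[HigherLocalField k n] dt k n j)) =
      if j ∈ (J : Finset (Fin n)) ∧ (I : Finset (Fin n)) = (J : Finset (Fin n)).erase j then
        (-1 : k) ^ ((J : Finset (Fin n)).filter (· < j)).card • e else 0 := by
  change TensorProduct.equivFinsuppOfBasisRight (dtBasis k n (p + 1))
    (e ⊗ₜ[HigherLocalField k n] wedge (dt k n j) (dtBasis k n p I)) J = _
  rw [TensorProduct.equivFinsuppOfBasisRight_apply_tmul_apply, repr_wedge_dt]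
  split_ifs
  -- The sign lies in F_n on one side and in k on the other; parity reduces both to ±1.
  · rcases Nat.even_or_odd ((J : Finset (Fin n)).filter (· < j)).card with h | h
    · rw [h.neg_one_pow, h.neg_one_pow, one_smul, one_smul]
    · rw [h.neg_one_pow, h.neg_one_pow, neg_smul, neg_smul, one_smul, one_smul]
  · rw [zero_smul]

variable [IsScalarTower k (HigherLocalField k n) E]

/-- The covariant derivative `∇_{∂/∂t_j}`. -/
def covariantDeriv (c : FormalConnection k n E) (j : Fin n) : E →ₗ[k] E :=
  (Finsupp.lapply j ∘ₗ (TensorProduct.equivFinsuppOfBasisRight (M := E)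
    (dt k n)).toLinearMap).restrictScalars k ∘ₗ c.nabla

theorem covariantDeriv_apply (c : FormalConnection k n E) (j : Fin n) (e : E) :
    c.covariantDeriv j e = TensorProduct.equivFinsuppOfBasisRight (dt k n) (c.nabla e) j := rfl

theorem covariantDeriv_smul (c : FormalConnection k n E) (j : Fin n) (f : HigherLocalField k n)
    (e : E) : c.covariantDeriv j (f • e) = partialDeriv k n j f • e + f • c.covariantDeriv j e := by
  rw [covariantDeriv_apply, c.leibniz, map_add, Finsupp.add_apply, map_smul, Finsupp.smul_apply,
    TensorProduct.equivFinsuppOfBasisRight_apply_tmul_apply, repr_d, add_comm]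
  rfl

theorem nabla_eq_sum (c : FormalConnection k n E) (e : E) :
    c.nabla e = ∑ j, c.covariantDeriv j e ⊗ₜ[HigherLocalField k n] dt k n j := by
  refine (TensorProduct.equivFinsuppOfBasisRight (M := E) (dt k n)).injective ?_
  ext j
  rw [map_sum, Finsupp.finsetSum_apply, Finset.sum_eq_single j]
  · rw [TensorProduct.equivFinsuppOfBasisRight_apply_tmul_apply, Module.Basis.repr_self,
      Finsupp.single_eq_same, one_smul, covariantDeriv_apply]
  · intro i _ hij
    rw [TensorProduct.equivFinsuppOfBasisRight_apply_tmul_apply, Module.Basis.repr_self,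
      Finsupp.single_eq_of_ne hij.symm, zero_smul]
  · exact fun h => absurd (Finset.mem_univ j) h

/-- The coefficients of an `E`-valued `p`-form, as a family indexed by all subsets of
`{1, …, n}`. -/
def toFamily (p : ℕ) :
    E ⊗[HigherLocalField k n] Forms k n p →ₗ[k] (Finset (Fin n) → E) :=
  LinearMap.pi fun J => if h : J.card = p then
    (coeff (Set.powersetCard.ofCard h)).restrictScalars k else 0

theorem toFamily_of_card {p : ℕ} {J : Finset (Fin n)} (h : J.card = p)
    (x : E ⊗[HigherLocalField k n] Forms k n p) :
    toFamily (k := k) p x J = coeff (Set.powersetCard.ofCard h) x := by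
  rw [toFamily, LinearMap.pi_apply, dif_pos h]
  rfl

theorem toFamily_of_card_ne {p : ℕ} {J : Finset (Fin n)} (h : J.card ≠ p)
    (x : E ⊗[HigherLocalField k n] Forms k n p) : toFamily (k := k) p x J = 0 := by
  rw [toFamily, LinearMap.pi_apply, dif_neg h]
  rfl

theorem toFamily_injective (p : ℕ) :
    Function.Injective (toFamily p : E ⊗[HigherLocalField k n] Forms k n p →ₗ[k] _) := by
  intro x y h
  refine (TensorProduct.equivFinsuppOfBasisRight (M := E) (dtBasis k n p)).injective ?_
  ext ⟨J, hJ⟩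
  have := congrFun h J
  rwa [toFamily_of_card hJ, toFamily_of_card hJ] at this

/-- Truncation to degree p, needed because a primitive in the total Koszul complex need not be
homogeneous. -/
theorem exists_toFamily_eq (p : ℕ) (y : Finset (Fin n) → E) :
    ∃ x : E ⊗[HigherLocalField k n] Forms k n p,
      toFamily (k := k) p x = fun J => if J.card = p then y J else 0 := by
  refine ⟨(TensorProduct.equivFinsuppOfBasisRight (M := E) (dtBasis k n p)).symm
    (Finsupp.equivFunOnFinite.symm fun J => y J), ?_⟩
  funext J
  split_ifs with h
  · rw [toFamily_of_card h]
    change TensorProduct.equivFinsuppOfBasisRight (dtBasis k n p) _ _ = _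
    rw [LinearEquiv.apply_symm_apply]
    rfl
  · rw [toFamily_of_card_ne h]

/-- Expand ∇ e_I = ∑ D_j e_I ⊗ dt_j; for given j ∈ J only I = J \ {j} contributes. -/
theorem coeff_extend (c : FormalConnection k n E) (p : ℕ)
    (x : E ⊗[HigherLocalField k n] Forms k n p) (J : Set.powersetCard (Fin n) (p + 1)) :
    coeff J (c.extend p x) = koszul c.covariantDeriv (toFamily p x) J := by
  have h1 : coeff J (c.extend p x) = ∑ I : Set.powersetCard (Fin n) p, ∑ j,
      if j ∈ (J : Finset (Fin n)) ∧ (I : Finset (Fin n)) = (J : Finset (Fin n)).erase j then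
        (-1 : k) ^ ((J : Finset (Fin n)).filter (· < j)).card • c.covariantDeriv j (coeff I x)
      else 0 := by
    rw [extend, LinearMap.sum_apply, map_sum]
    refine Finset.sum_congr rfl fun I _ => ?_
    change coeff J (wedgeRight (dtBasis k n p I) (c.nabla (coeff I x))) = _
    rw [nabla_eq_sum, map_sum, map_sum]
    exact Finset.sum_congr rfl fun j _ => coeff_wedgeRight _ j I J
  rw [h1, Finset.sum_comm, koszul_apply, ← Finset.sum_subset (Finset.subset_univ (J : Finset _))]
  · refine Finset.sum_congr rfl fun j hj => ?_
    have hcard : ((J : Finset (Fin n)).erase j).card = p := by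
      rw [Finset.card_erase_of_mem hj, Set.powersetCard.card_eq, Nat.add_sub_cancel]
    rw [toFamily_of_card hcard, Finset.sum_eq_single (Set.powersetCard.ofCard hcard)]
    · rw [if_pos ⟨hj, rfl⟩]
    · intro I _ hI
      rw [if_neg]
      exact fun h => hI (Subtype.ext h.2)
    · exact fun h => absurd (Finset.mem_univ _) h
  · intro j _ hj
    exact Finset.sum_eq_zero fun I _ => if_neg fun h => hj h.1

theorem koszul_toFamily (c : FormalConnection k n E) (p : ℕ)
    (x : E ⊗[HigherLocalField k n] Forms k n p) :
    koszul c.covariantDeriv (toFamily p x) = toFamily (p + 1) (c.extend p x) := by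
  funext J
  by_cases h : J.card = p + 1
  · rw [toFamily_of_card h, coeff_extend]
    rfl
  · rw [toFamily_of_card_ne h, koszul_apply]
    refine Finset.sum_eq_zero fun j hj => ?_
    rw [toFamily_of_card_ne, map_zero, smul_zero]
    rw [Finset.card_erase_of_mem hj]
    have := Finset.card_pos.mpr ⟨j, hj⟩
    omega

/-- For i < j the coefficient of dt_i ∧ dt_j in ∇∇e is the commutator of D_i and D_j applied to e.
-/
theorem covariantDeriv_comm (c : FormalConnection k n E) (hc : c.IsFlat) (i j : Fin n) (e : E) :
    c.covariantDeriv i (c.covariantDeriv j e) = c.covariantDeriv j (c.covariantDeriv i e) := by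
  wlog hij : i < j generalizing i j
  · rcases lt_or_eq_of_le (not_lt.mp hij) with h | rfl
    · exact (this j i h).symm
    · rfl
  obtain ⟨x, hx⟩ := exists_toFamily_eq (k := k) 0 fun _ : Finset (Fin n) => e
  have h0 : koszul c.covariantDeriv (koszul c.covariantDeriv (toFamily 0 x)) = 0 := by
    rw [koszul_toFamily, koszul_toFamily]
    have : c.extend 1 (c.extend 0 x) = 0 := LinearMap.congr_fun hc x
    exact (congrArg (toFamily (k := k) 2) this).trans (map_zero _)
  have h1 : ∀ l : Fin n, koszul c.covariantDeriv (toFamily 0 x) {l} = c.covariantDeriv l e := by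
    intro l
    rw [koszul_apply, Finset.sum_singleton, hx]
    simp [Finset.filter_singleton]
  have h2 := congrFun h0 {i, j}
  have e1 : ({i, j} : Finset (Fin n)).erase i = {j} := by
    rw [Finset.erase_insert (by simpa using hij.ne)]
  have e2 : ({i, j} : Finset (Fin n)).erase j = {i} := by
    rw [Finset.pair_comm, Finset.erase_insert (by simpa using hij.ne')]
  rw [koszul_apply, Finset.sum_pair hij.ne, e1, e2, h1, h1] at h2
  simpa [Finset.filter_insert, Finset.filter_singleton, hij, hij.not_gt, ← sub_eq_add_neg,
    sub_eq_zero] using h2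

/-- H^p embeds in the total Koszul homology: if a cocycle of degree p is a total boundary, the part
of degree p - 1 of a primitive is again a primitive. -/
theorem finiteDimensional_cocycles_quotient (c : FormalConnection k n E)
    (h : (koszul c.covariantDeriv).HasFiniteHomology) (p : ℕ) :
    FiniteDimensional k (c.cocycles p ⧸ (c.coboundaries p).comap (c.cocycles p).subtype) := by
  obtain ⟨W, _, hW⟩ := h
  let R := LinearMap.range (koszul c.covariantDeriv)
  let φ : c.cocycles p →ₗ[k] (Finset (Fin n) → E) ⧸ R :=
    R.mkQ ∘ₗ toFamily p ∘ₗ (c.cocycles p).subtype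
  have hφ : LinearMap.range φ ≤ W.map R.mkQ := by
    rintro _ ⟨x, rfl⟩
    have hx : toFamily p (x : E ⊗[HigherLocalField k n] Forms k n p) ∈
        LinearMap.ker (koszul c.covariantDeriv) := by
      rw [LinearMap.mem_ker, koszul_toFamily, show c.extend p x = 0 from x.2, map_zero]
    obtain ⟨w, hw, r, hr, hwr⟩ := Submodule.mem_sup.mp (hW hx)
    refine ⟨w, hw, ?_⟩
    change _ = R.mkQ (toFamily p (x : E ⊗[HigherLocalField k n] Forms k n p))
    rw [← hwr, map_add, Submodule.mkQ_apply _ r, (Submodule.Quotient.mk_eq_zero R).mpr hr, add_zero]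
  have hker : LinearMap.ker φ ≤ (c.coboundaries p).comap (c.cocycles p).subtype := by
    intro x hx
    obtain ⟨y, hy⟩ : toFamily p (x : E ⊗[HigherLocalField k n] Forms k n p) ∈ R :=
      (Submodule.Quotient.mk_eq_zero R).mp hx
    change (x : E ⊗[HigherLocalField k n] Forms k n p) ∈ c.coboundaries p
    cases p with
    | zero =>
      -- A Koszul boundary vanishes at ∅, its sum being empty, so a 0-form that is a boundary is
      -- zero.
      refine (Submodule.mem_bot k).mpr (toFamily_injective (k := k) 0 ?_)
      rw [map_zero, ← hy]
      funext J
      by_cases hJ : J.card = 0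
      · rw [koszul_apply, Finset.card_eq_zero.mp hJ, Finset.sum_empty]
        rfl
      · rw [hy, toFamily_of_card_ne hJ]
        rfl
    | succ p =>
      obtain ⟨z, hz⟩ := exists_toFamily_eq (k := k) p y
      refine ⟨z, toFamily_injective (k := k) (p + 1) ?_⟩
      rw [← koszul_toFamily, hz]
      funext J
      by_cases hJ : J.card = p + 1
      · rw [← hy, koszul_apply, koszul_apply]
        refine Finset.sum_congr rfl fun j hj => ?_
        rw [if_pos]
        rw [Finset.card_erase_of_mem hj, hJ, Nat.add_sub_cancel]
      · rw [← hz, koszul_toFamily, toFamily_of_card_ne hJ, toFamily_of_card_ne hJ]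
  have : FiniteDimensional k (LinearMap.range φ) := Submodule.finiteDimensional_of_le hφ
  have : FiniteDimensional k (c.cocycles p ⧸ LinearMap.ker φ) :=
    Module.Finite.equiv φ.quotKerEquivRange.symm
  exact Module.Finite.of_surjective (Submodule.factor hker) (Submodule.factor_surjective hker)

end FormalConnection

end

theorem corollary1p8 {k : Type u} [Field k] [CharZero k] (n : ℕ)
    {E : Type v} [AddCommGroup E] [Module k E] [Module (HigherLocalField k n) E]
    [IsScalarTower k (HigherLocalField k n) E] [FiniteDimensional (HigherLocalField k n) E]
    (c : FormalConnection k n E) (hc : c.IsFlat) (i : ℤ) :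
    FiniteDimensional k (c.deRhamCohomology i) := by
  cases i with
  | ofNat p =>
    exact c.finiteDimensional_cocycles_quotient
      (HigherLocalField.koszul_hasFiniteHomology n c.covariantDeriv c.covariantDeriv_smul
        (c.covariantDeriv_comm hc)) p
  | negSucc p => exact (inferInstance : FiniteDimensional k PUnit)
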